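/- Let $y>0$, $0\le\alpha<2\pi$ and $0<K<1$ be real numbers. Let $P^+$ be the set of primes $p$ with $\cos(y\ln p+\alpha)>K$, and let $P^-$ be the set of primes $p$ with $\cos(y\ln p+\alpha)<-K$. Then $$\sum_{p\in P^+}\frac1p=\infty\quad\text{and}\quad\sum_{p\in P^-}\frac1p=\infty.$$ -/

import Mathlib

open scoped ENNReal

/-- The set of primes `p` with `cos (y ln p + α) > K`. -/
def PPlus (y α K : ℝ) : Set ℕ :=
  {p : ℕ | p.Prime ∧ Real.cos (y * Real.log p + α) > K}

/-- The set of primes `p` with `cos (y ln p + α) < -K`. -/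
def PMinus (y α K : ℝ) : Set ℕ :=
  {p : ℕ | p.Prime ∧ Real.cos (y * Real.log p + α) < -K}

/-! Weight the primes by `p ^ (-σ)` and let `σ ↓ 1`. With `θ = y log p + α`, the constant Fourier
coefficient of `((1 + cos θ) / 2) ^ N` is `N.centralBinom / 4 ^ N`. The other frequencies only
contribute bounded terms, because `ζ` has neither pole nor zero on `re s = 1` away from `s = 1`. If
the sum over `P⁺` converged, the total would be at most `((1 + K) / 2) ^ N` times the total weight,
up to `O(1)`. For suitable `N` this is the smaller coefficient, contradicting the divergence of `∑ 1
/ p`. Shifting `α` by `π` turns `P⁻` into `P⁺`. -/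

/-- The indicator function of the primes. -/
noncomputable def primeIndicator (n : ℕ) : ℂ := if n.Prime then 1 else 0

lemma norm_primeIndicator_le (n : ℕ) : ‖primeIndicator n‖ ≤ 1 := by
  unfold primeIndicator; split_ifs <;> simp

lemma primeIndicator_summable {s : ℂ} (hs : 1 < s.re) : LSeriesSummable primeIndicator s :=
  LSeriesSummable_of_bounded_of_one_lt_re (fun n _ ↦ norm_primeIndicator_le n) hs

lemma primeIndicator_abscissa_lt {s : ℂ} (hs : 1 < s.re) :
    LSeries.abscissaOfAbsConv primeIndicator < s.re :=
  (LSeries.abscissaOfAbsConv_le_of_le_const ⟨1, fun n _ ↦ norm_primeIndicator_le n⟩).trans_lt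
    (by exact_mod_cast hs)

/-- The von Mangoldt function restricted to integers that are not prime. -/
noncomputable def vonMangoldtNonprime (n : ℕ) : ℂ :=
  if n.Prime then 0 else ArithmeticFunction.vonMangoldt n

lemma summable_norm_vonMangoldtNonprime_div :
    Summable fun n : ℕ ↦ ‖vonMangoldtNonprime n‖ / n := by
  -- Modulo 1 the residue class is all of `ℕ`.
  refine (ArithmeticFunction.vonMangoldt.summable_residueClass_non_primes_div
    (0 : ZMod 1)).congr fun n ↦ ?_
  have h0 : (n : ZMod 1) = 0 := Subsingleton.elim _ _
  unfold vonMangoldtNonprime ArithmeticFunction.vonMangoldt.residueClass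
  split_ifs
  · simp
  · simp [h0, abs_of_nonneg, ArithmeticFunction.vonMangoldt_nonneg]

lemma norm_term_vonMangoldtNonprime_le {s : ℂ} (hs : 1 < s.re) (n : ℕ) :
    ‖LSeries.term vonMangoldtNonprime s n‖ ≤ ‖vonMangoldtNonprime n‖ / n := by
  refine (LSeries.norm_term_le_of_re_le_re _ (s := 1) (by simpa using hs.le) n).trans ?_
  rw [LSeries.norm_term_eq]
  split_ifs with h
  · simp [h]
  · simp

lemma LSeries_logMul_primeIndicator {s : ℂ} (hs : 1 < s.re) :
    LSeries (LSeries.logMul primeIndicator) s =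
      -deriv riemannZeta s / riemannZeta s - LSeries vonMangoldtNonprime s := by
  rw [← ArithmeticFunction.LSeries_vonMangoldt_eq_deriv_riemannZeta_div hs, ← LSeries_sub
    (ArithmeticFunction.LSeriesSummable_vonMangoldt hs)
    (summable_norm_vonMangoldtNonprime_div.of_norm_bounded
      (norm_term_vonMangoldtNonprime_le hs))]
  congr 1
  funext n
  by_cases h : n.Prime
  · simp [LSeries.logMul, primeIndicator, vonMangoldtNonprime, h,
      ArithmeticFunction.vonMangoldt_apply_prime h, Complex.natCast_log]
  · simp [LSeries.logMul, primeIndicator, vonMangoldtNonprime, h]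

lemma continuousAt_logDeriv_riemannZeta {s : ℂ} (hs : 1 ≤ s.re) (h1 : s ≠ 1) :
    ContinuousAt (fun s ↦ -deriv riemannZeta s / riemannZeta s) s := by
  have hd : DifferentiableOn ℂ riemannZeta {1}ᶜ := fun z hz ↦
    (differentiableAt_riemannZeta hz).differentiableWithinAt
  have hn : ({1}ᶜ : Set ℂ) ∈ nhds s := isOpen_compl_singleton.mem_nhds h1
  exact ((hd.deriv isOpen_compl_singleton).continuousOn.continuousAt hn).neg.div
    (differentiableAt_riemannZeta h1).continuousAt (riemannZeta_ne_zero_of_one_le_re hs)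

/-- Away from the real axis, the L-series of the primes stays bounded up to the line `re s = 1`. -/
lemma exists_norm_LSeries_primeIndicator_le {t : ℝ} (ht : t ≠ 0) :
    ∃ C, ∀ σ ∈ Set.Ioc (1 : ℝ) 2, ‖LSeries primeIndicator (σ + t * Complex.I)‖ ≤ C := by
  have hre (σ : ℝ) : (σ + t * Complex.I : ℂ).re = σ := by simp
  obtain ⟨D, hD⟩ := (isCompact_Icc (a := (1 : ℝ)) (b := 2)).exists_bound_of_continuousOn
    (f := fun σ : ℝ ↦ -deriv riemannZeta (σ + t * Complex.I) / riemannZeta (σ + t * Complex.I))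
    (fun σ hσ ↦ by
      refine (ContinuousAt.comp (f := fun σ : ℝ ↦ (σ + t * Complex.I : ℂ))
        (continuousAt_logDeriv_riemannZeta ?_ ?_) (by fun_prop)).continuousWithinAt
      · rw [hre]; exact hσ.1
      · intro h
        exact ht (by simpa using congrArg Complex.im h))
  set E := ∑' n : ℕ, ‖vonMangoldtNonprime n‖ / n
  -- Bounding the derivative in `σ` and integrating from `σ = 2` avoids choosing a logarithm of `ζ`.
  have hderiv (σ : ℝ) (hσ : σ ∈ Set.Ioc (1 : ℝ) 2) :
      HasDerivWithinAt (fun σ : ℝ ↦ LSeries primeIndicator (σ + t * Complex.I))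
        (-LSeries (LSeries.logMul primeIndicator) (σ + t * Complex.I)) (Set.Ioc 1 2) σ := by
    have h := LSeries_hasDerivAt
      (primeIndicator_abscissa_lt (s := σ + t * Complex.I) (by rw [hre]; exact hσ.1))
    have h2 : HasDerivAt (fun z : ℂ ↦ z + t * Complex.I) 1 (σ : ℂ) :=
      (hasDerivAt_id _).add_const _
    simpa using (h.comp (σ : ℂ) h2).comp_ofReal.hasDerivWithinAt
  have hbound (σ : ℝ) (hσ : σ ∈ Set.Ioc (1 : ℝ) 2) :
      ‖-LSeries (LSeries.logMul primeIndicator) (σ + t * Complex.I)‖ ≤ D + E := by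
    have hs : 1 < (σ + t * Complex.I : ℂ).re := by rw [hre]; exact hσ.1
    rw [norm_neg, LSeries_logMul_primeIndicator hs]
    refine (norm_sub_le _ _).trans (add_le_add (hD σ ⟨hσ.1.le, hσ.2⟩) ?_)
    exact tsum_of_norm_bounded summable_norm_vonMangoldtNonprime_div.hasSum
      (norm_term_vonMangoldtNonprime_le hs)
  refine ⟨(D + E) + ‖LSeries primeIndicator ((2 : ℝ) + t * Complex.I)‖, fun σ hσ ↦ ?_⟩
  have h := (convex_Ioc (1 : ℝ) 2).norm_image_sub_le_of_norm_hasDerivWithin_le hderiv hbound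
    (x := 2) (y := σ) (by simp) hσ
  have h0 : 0 ≤ D + E := (norm_nonneg _).trans (hbound σ hσ)
  have h1 : ‖σ - 2‖ ≤ 1 := by
    rw [Real.norm_eq_abs, abs_le]; constructor <;> linarith [hσ.1, hσ.2]
  have h2 := norm_le_insert' (LSeries primeIndicator (σ + t * Complex.I))
    (LSeries primeIndicator ((2 : ℝ) + t * Complex.I))
  have h3 : (D + E) * ‖σ - 2‖ ≤ D + E := mul_le_of_le_one_right h0 h1
  linarith

/-- The weight `n ^ (-σ)` on primes, and `0` elsewhere. -/
noncomputable def primeWeight (σ : ℝ) (n : ℕ) : ℝ := if n.Prime then (n : ℝ) ^ (-σ) else 0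

lemma primeWeight_nonneg (σ : ℝ) (n : ℕ) : 0 ≤ primeWeight σ n := by
  unfold primeWeight; split_ifs <;> positivity

lemma term_primeIndicator (σ t : ℝ) (n : ℕ) :
    LSeries.term primeIndicator (σ + t * Complex.I) n =
      primeWeight σ n * Complex.exp (-(t * Real.log n) * Complex.I) := by
  by_cases h : n.Prime
  · have h0 : (n : ℂ) ≠ 0 := by exact_mod_cast h.ne_zero
    rw [LSeries.term_of_ne_zero h.ne_zero, primeWeight, primeIndicator, if_pos h, if_pos h,
      Complex.ofReal_cpow n.cast_nonneg, one_div, ← Complex.cpow_neg, Complex.ofReal_natCast,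
      Complex.cpow_def_of_ne_zero h0, Complex.cpow_def_of_ne_zero h0, ← Complex.exp_add,
      ← Complex.natCast_log]
    congr 1
    push_cast
    ring
  · rcases eq_or_ne n 0 with rfl | h0
    · simp [primeWeight, Nat.not_prime_zero]
    · simp [LSeries.term_of_ne_zero h0, primeWeight, primeIndicator, h]

lemma summable_primeWeight {σ : ℝ} (hσ : 1 < σ) : Summable (primeWeight σ) := by
  have h : LSeriesSummable primeIndicator (σ + (0 : ℝ) * Complex.I) :=
    primeIndicator_summable (by simpa using hσ)
  have h2 : Summable fun n ↦ (primeWeight σ n : ℂ) := by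
    refine h.congr fun n ↦ ?_
    rw [term_primeIndicator]; simp
  exact_mod_cast h2

/-- Binomial expansion of `cos (θ / 2) ^ (2 * N)` in exponentials; `j = N` is the constant term. -/
lemma one_add_cos_div_two_pow (θ : ℝ) (N : ℕ) :
    ((((1 + Real.cos θ) / 2) ^ N : ℝ) : ℂ) = ∑ j ∈ Finset.range (2 * N + 1),
      ((2 * N).choose j / 4 ^ N : ℂ) * Complex.exp (((j : ℝ) - N : ℝ) * θ * Complex.I) := by
  have h1 : (1 + Real.cos θ) / 2 = Real.cos (θ / 2) ^ 2 := by rw [Real.cos_sq]; ring_nf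
  have h4 : (2 : ℂ) ^ (2 * N) = 4 ^ N := by rw [pow_mul]; norm_num
  rw [h1, ← pow_mul]
  push_cast
  rw [Complex.cos, div_pow, add_pow, h4, Finset.sum_div]
  refine Finset.sum_congr rfl fun j hj ↦ ?_
  have hj' : j ≤ 2 * N := by simpa [Nat.lt_succ_iff] using hj
  rw [← Complex.exp_nat_mul, ← Complex.exp_nat_mul, ← Complex.exp_add, mul_comm,
    ← div_mul_eq_mul_div]
  congr 2
  push_cast [Nat.cast_sub hj']
  ring

/-- The average of `((1 + cos θ) / 2) ^ N` over the primes is governed by its constant Fourier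
coefficient. -/
lemma exists_centralBinom_mul_tsum_primeWeight_le {y : ℝ} (hy : y ≠ 0) (α : ℝ) (N : ℕ) :
    ∃ C, ∀ σ ∈ Set.Ioc (1 : ℝ) 2, (N.centralBinom / 4 ^ N : ℝ) * ∑' n, primeWeight σ n - C ≤
      ∑' n : ℕ, primeWeight σ n * ((1 + Real.cos (y * Real.log n + α)) / 2) ^ N := by
  have hex (j : ℕ) : ∃ C, j ≠ N → ∀ σ ∈ Set.Ioc (1 : ℝ) 2,
      ‖LSeries primeIndicator (σ + (-((j - N) * y) : ℝ) * Complex.I)‖ ≤ C := by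
    by_cases h : j = N
    · exact ⟨0, fun h' ↦ (h' h).elim⟩
    · obtain ⟨C, hC⟩ := exists_norm_LSeries_primeIndicator_le (t := -((j - N) * y))
        (neg_ne_zero.2 (mul_ne_zero (sub_ne_zero.2 (by exact_mod_cast h)) hy))
      exact ⟨C, fun _ ↦ hC⟩
  choose C hC using hex
  let c (j : ℕ) : ℂ := ((2 * N).choose j / 4 ^ N : ℂ) *
    Complex.exp (((j : ℝ) - N : ℝ) * α * Complex.I)
  have hNmem : N ∈ Finset.range (2 * N + 1) := by simp; omega
  refine ⟨∑ j ∈ (Finset.range (2 * N + 1)).erase N, ‖c j‖ * C j, fun σ hσ ↦ ?_⟩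
  have hsum (j : ℕ) : HasSum (fun n ↦ c j *
      LSeries.term primeIndicator (σ + (-((j - N) * y) : ℝ) * Complex.I) n)
      (c j * LSeries primeIndicator (σ + (-((j - N) * y) : ℝ) * Complex.I)) :=
    (primeIndicator_summable (by simpa using hσ.1)).LSeriesHasSum.mul_left _
  have hA := hasSum_sum (s := Finset.range (2 * N + 1)) fun j _ ↦ hsum j
  have hpt (n : ℕ) : ∑ j ∈ Finset.range (2 * N + 1), c j *
      LSeries.term primeIndicator (σ + (-((j - N) * y) : ℝ) * Complex.I) n =
      ((primeWeight σ n * ((1 + Real.cos (y * Real.log n + α)) / 2) ^ N : ℝ) : ℂ) := by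
    rw [Complex.ofReal_mul, one_add_cos_div_two_pow, Finset.mul_sum]
    refine Finset.sum_congr rfl fun j _ ↦ ?_
    rw [term_primeIndicator, mul_left_comm, mul_assoc, ← Complex.exp_add]
    congr 3
    push_cast
    ring
  simp only [hpt] at hA
  have hAeq := hA.tsum_eq
  rw [← Complex.ofReal_tsum, ← Finset.add_sum_erase _ _ hNmem] at hAeq
  -- The frequency-zero term is the main term, unbounded as `σ ↓ 1`.
  have hP : LSeries primeIndicator (σ + (-(((N : ℝ) - N) * y) : ℝ) * Complex.I) =
      ((∑' n, primeWeight σ n : ℝ) : ℂ) := by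
    rw [Complex.ofReal_tsum]
    refine tsum_congr fun n ↦ ?_
    rw [term_primeIndicator]; simp
  have hc : c N = ((N.centralBinom / 4 ^ N : ℝ) : ℂ) := by
    simp [c, Nat.centralBinom]
  rw [hP, hc, ← Complex.ofReal_mul, ← sub_eq_iff_eq_add', ← Complex.ofReal_sub] at hAeq
  have hnorm := norm_sum_le_of_le ((Finset.range (2 * N + 1)).erase N) (fun j hj ↦
    (norm_mul_le (c j) _).trans (mul_le_mul_of_nonneg_left
      (hC j (Finset.ne_of_mem_erase hj) σ hσ) (norm_nonneg _)))
  rw [← hAeq, Complex.norm_real, Real.norm_eq_abs] at hnorm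
  linarith [neg_abs_le ((∑' n : ℕ, primeWeight σ n *
    ((1 + Real.cos (y * Real.log n + α)) / 2) ^ N) -
      (N.centralBinom / 4 ^ N : ℝ) * ∑' n, primeWeight σ n)]

/-- The central coefficient is at least `1 / (2 * N)`, so it decays slower than any geometric
sequence. -/
lemma exists_pow_lt_centralBinom_div {r : ℝ} (h0 : 0 ≤ r) (h1 : r < 1) :
    ∃ N : ℕ, r ^ N < N.centralBinom / 4 ^ N := by
  obtain ⟨N, hN, hpos⟩ := (((tendsto_self_mul_const_pow_of_lt_one h0 h1).eventually
    (gt_mem_nhds (show (0 : ℝ) < 1 / 2 by norm_num))).and (Filter.eventually_gt_atTop 0)).exists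
  refine ⟨N, ?_⟩
  have hc : (4 : ℝ) ^ N ≤ 2 * N * N.centralBinom := by
    exact_mod_cast Nat.four_pow_le_two_mul_self_mul_centralBinom N hpos
  have hb : (0 : ℝ) < N.centralBinom := by exact_mod_cast N.centralBinom_pos
  rw [lt_div_iff₀ (by positivity)]
  calc r ^ N * 4 ^ N ≤ r ^ N * (2 * N * N.centralBinom) := by gcongr
    _ = 2 * (N * r ^ N) * N.centralBinom := by ring
    _ < 1 * N.centralBinom := by gcongr; linarith
    _ = N.centralBinom := one_mul _

/-- A uniform bound would pass to finite partial sums of `∑ 1 / p` as `σ ↓ 1`. -/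
lemma not_bddAbove_tsum_primeWeight (M : ℝ) :
    ¬ ∀ σ ∈ Set.Ioc (1 : ℝ) 2, ∑' n, primeWeight σ n ≤ M := by
  intro h
  refine Nat.Primes.not_summable_one_div (summable_of_sum_le (c := M) (fun _ ↦ by positivity)
    fun u ↦ ?_)
  have hcont : Filter.Tendsto (fun σ : ℝ ↦ ∑ p ∈ u, ((p : ℕ) : ℝ) ^ (-σ))
      (nhdsWithin 1 (Set.Ioi 1)) (nhds (∑ p ∈ u, 1 / ((p : ℕ) : ℝ))) := by
    have : ContinuousAt (fun σ : ℝ ↦ ∑ p ∈ u, ((p : ℕ) : ℝ) ^ (-σ)) 1 :=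
      tendsto_finsetSum _ fun p _ ↦ (Real.continuousAt_const_rpow
        (by exact_mod_cast p.2.ne_zero)).comp continuousAt_neg
    simpa [Real.rpow_neg_one] using this.tendsto.mono_left nhdsWithin_le_nhds
  refine le_of_tendsto hcont ?_
  filter_upwards [Ioc_mem_nhdsGT (show (1 : ℝ) < 2 by norm_num)] with σ hσ
  refine le_trans ?_ (h σ hσ)
  let e : Nat.Primes ↪ ℕ := ⟨_, Nat.Primes.coe_nat_injective⟩
  calc ∑ p ∈ u, ((p : ℕ) : ℝ) ^ (-σ) = ∑ p ∈ u, primeWeight σ (e p) :=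
        Finset.sum_congr rfl fun p _ ↦ (if_pos p.2).symm
    _ = ∑ n ∈ u.map e, primeWeight σ n := (Finset.sum_map u e _).symm
    _ ≤ _ := (summable_primeWeight hσ.1).sum_le_tsum _ fun n _ ↦ primeWeight_nonneg σ n

lemma not_summable_PPlus {y : ℝ} (hy : y ≠ 0) (α : ℝ) {K : ℝ} (hK : 0 < K) (hK' : K < 1) :
    ¬ Summable ((PPlus y α K).indicator fun n : ℕ ↦ (1 : ℝ) / n) := by
  intro hS
  set r := (1 + K) / 2 with hr
  obtain ⟨N, hN⟩ := exists_pow_lt_centralBinom_div (r := r) (by linarith) (by linarith)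
  obtain ⟨C, hC⟩ := exists_centralBinom_mul_tsum_primeWeight_le hy α N
  set B := ∑' n, (PPlus y α K).indicator (fun n : ℕ ↦ (1 : ℝ) / n) n
  have hd : 0 < (N.centralBinom / 4 ^ N : ℝ) - r ^ N := sub_pos.2 hN
  refine not_bddAbove_tsum_primeWeight ((B + C) / ((N.centralBinom / 4 ^ N : ℝ) - r ^ N))
    fun σ hσ ↦ ?_
  have hw := summable_primeWeight hσ.1
  have h0 (n : ℕ) : 0 ≤ (1 + Real.cos (y * Real.log n + α)) / 2 := by
    linarith [Real.neg_one_le_cos (y * Real.log n + α)]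
  have h1 (n : ℕ) : ((1 + Real.cos (y * Real.log n + α)) / 2) ^ N ≤ 1 :=
    pow_le_one₀ (h0 n) (by linarith [Real.cos_le_one (y * Real.log n + α)])
  -- On `P⁺` the power is at most 1 and the weight at most `1 / n`; at other primes the power is at
  -- most `r ^ N`.
  have hpt (n : ℕ) : primeWeight σ n * ((1 + Real.cos (y * Real.log n + α)) / 2) ^ N ≤
      (PPlus y α K).indicator (fun n : ℕ ↦ (1 : ℝ) / n) n + primeWeight σ n * r ^ N := by
    have hnn := primeWeight_nonneg σ n
    have hr0 : 0 ≤ r ^ N := by positivity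
    by_cases hn : n ∈ PPlus y α K
    · have hle : primeWeight σ n ≤ 1 / n := by
        rw [primeWeight, if_pos hn.1, one_div, ← Real.rpow_neg_one]
        exact Real.rpow_le_rpow_of_exponent_le (by exact_mod_cast hn.1.one_lt.le)
          (by linarith [hσ.1])
      rw [Set.indicator_of_mem hn]
      have := mul_le_of_le_one_right hnn (h1 n)
      have := mul_nonneg hnn hr0
      linarith
    · rw [Set.indicator_of_notMem hn, zero_add]
      by_cases hp : n.Prime
      · have hcos : Real.cos (y * Real.log n + α) ≤ K := not_lt.1 fun h ↦ hn ⟨hp, h⟩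
        exact mul_le_mul_of_nonneg_left (pow_le_pow_left₀ (h0 n) (by linarith) N) hnn
      · simp [primeWeight, hp]
  have hsum := (hw.of_nonneg_of_le (fun n ↦ mul_nonneg (primeWeight_nonneg σ n)
    (pow_nonneg (h0 n) N)) fun n ↦ mul_le_of_le_one_right (primeWeight_nonneg σ n)
      (h1 n)).tsum_le_tsum hpt (hS.add (hw.mul_right _))
  rw [hS.tsum_add (hw.mul_right _), tsum_mul_right] at hsum
  rw [le_div_iff₀ hd]
  linarith [hC σ hσ]

lemma tsum_PPlus_eq_top {y : ℝ} (hy : y ≠ 0) (α : ℝ) {K : ℝ} (hK : 0 < K) (hK' : K < 1) :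
    (∑' p : PPlus y α K, 1 / ((p : ℕ) : ℝ≥0∞)) = ∞ := by
  by_contra h
  refine not_summable_PPlus hy α hK hK' ?_
  rw [← summable_subtype_iff_indicator]
  refine (ENNReal.summable_toReal h).congr fun p ↦ ?_
  simp

lemma PMinus_eq_PPlus_add_pi (y α K : ℝ) : PMinus y α K = PPlus y (α + Real.pi) K := by
  ext p
  simp only [PMinus, PPlus, Set.mem_ofPred_eq, ← add_assoc, Real.cos_add_pi, gt_iff_lt, lt_neg]

theorem theorem1 (y α K : ℝ) (hy : 0 < y) (hα : 0 ≤ α) (hα' : α < 2 * Real.pi)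
    (hK : 0 < K) (hK' : K < 1) :
    (∑' p : PPlus y α K, 1 / ((p : ℕ) : ℝ≥0∞)) = ∞ ∧
      (∑' p : PMinus y α K, 1 / ((p : ℕ) : ℝ≥0∞)) = ∞ := by
  rw [PMinus_eq_PPlus_add_pi]
  exact ⟨tsum_PPlus_eq_top hy.ne' _ hK hK', tsum_PPlus_eq_top hy.ne' _ hK hK'⟩
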